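/- **Generalized Poincaré inequality.** For $L>0$ let $\mathcal K=[0,L]^3$ be the cube of side $L$ with periodic boundary conditions (the 3-torus), and for $\varphi\in\mathbb R$ write $\nabla_\varphi=\nabla+\mathrm i\,\boldsymbol\varphi/L$ with $\boldsymbol\varphi=(0,0,\varphi)$. For every $\varphi$ with $|\varphi|<\pi$ there are constants $c>0$ and $C<\infty$, depending only on $\varphi$, such that for all $L>0$, all (Lebesgue measurable) subsets $\Omega\subset\mathcal K$ and all complex-valued functions $f\in H^1(\mathcal K)$ on the torus, $$\|\nabla_\varphi f\|_{L^2(\Omega)}^2\;\ge\;\frac{\varphi^2}{L^2}\|f\|_{L^2(\mathcal K)}^2+\frac{c}{L^2}\big\|f-L^{-3}\langle 1,f\rangle_{\mathcal K}\big\|_{L^2(\mathcal K)}^2-C\Big(\|\nabla_\varphi f\|_{L^2(\mathcal K)}^2+\frac1{L^2}\|f\|_{L^2(\mathcal K)}^2\Big)\Big(\frac{|\Omega^c|}{|\mathcal K|}\Big)^{1/2}.$$ Here $\langle 1,f\rangle_{\mathcal K}=\int_{\mathcal K}f(\mathbf r)\,d\mathbf r$, $\Omega^c=\mathcal K\setminus\Omega$,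 and $|\cdot|$ denotes volume; $H^1(\mathcal K)$ is the space of $f\in L^2(\mathcal K)$ whose weak gradient on the torus (tested against smooth $L$-periodic functions) is in $L^2(\mathcal K)$. -/

import Mathlib

open MeasureTheory
open scoped ContDiff

noncomputable section

namespace TwistedPoincare

/-- The fundamental cube `[0, L]³`; with periodic boundary conditions it is the torus `𝒦`. -/
def cube (L : ℝ) : Set (Fin 3 → ℝ) := Set.Icc 0 (fun _ => L)

/-- Smooth complex functions on the torus: smooth functions on `ℝ³` that are `L`-periodic in each
coordinate. -/
structure IsPeriodicSmooth (L : ℝ) (ψ : (Fin 3 → ℝ) → ℂ) : Prop where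
  smooth : ContDiff ℝ ∞ ψ
  periodic : ∀ (j : Fin 3) (x : Fin 3 → ℝ), ψ (x + Pi.single j L) = ψ x

/-- `g` is the `j`-th weak partial derivative of `f` on the torus (test functions are the smooth
periodic functions, so a jump of `f` across opposite faces of the cube is not ignored). -/
def HasWeakPartial (L : ℝ) (f : (Fin 3 → ℝ) → ℂ) (j : Fin 3) (g : (Fin 3 → ℝ) → ℂ) : Prop :=
  ∀ ψ : (Fin 3 → ℝ) → ℂ, IsPeriodicSmooth L ψ →
    ∫ x in cube L, f x * fderiv ℝ ψ x (Pi.single j 1) = -∫ x in cube L, g x * ψ x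

/-- `f` belongs to the Sobolev space `H¹` of the torus and `G` is its weak gradient. Only the values
of `f` and `G` almost everywhere on the cube matter. -/
structure HasH1Gradient (L : ℝ) (f : (Fin 3 → ℝ) → ℂ) (G : Fin 3 → (Fin 3 → ℝ) → ℂ) : Prop where
  memLp : MemLp f 2 (volume.restrict (cube L))
  memLp_gradient : ∀ j, MemLp (G j) 2 (volume.restrict (cube L))
  weak : ∀ j, HasWeakPartial L f j (G j)

/-- The vector `(0, 0, φ)`. -/
def phaseVector (φ : ℝ) : Fin 3 → ℝ := ![0, 0, φ]

/-- `∇_φ f = (∇ + i (0, 0, φ) / L) f`, where `G` is the gradient of `f`. -/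
def twistedGradient (φ L : ℝ) (f : (Fin 3 → ℝ) → ℂ) (G : Fin 3 → (Fin 3 → ℝ) → ℂ) :
    Fin 3 → (Fin 3 → ℝ) → ℂ :=
  fun j x => G j x + Complex.I * ((phaseVector φ j / L : ℝ) : ℂ) * f x

/-- `‖u‖²` in `L²(S)` for a complex function `u`. -/
def normSq (S : Set (Fin 3 → ℝ)) (u : (Fin 3 → ℝ) → ℂ) : ℝ :=
  ∫ x in S, ‖u x‖ ^ 2

/-- `‖V‖²` in `L²(S)` for a complex vector field `V`. -/
def vecNormSq (S : Set (Fin 3 → ℝ)) (V : Fin 3 → (Fin 3 → ℝ) → ℂ) : ℝ :=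
  ∫ x in S, ∑ j, ‖V j x‖ ^ 2

/-- The mean `L⁻³ ⟨1, f⟩` of `f` over the cube. -/
def mean (L : ℝ) (f : (Fin 3 → ℝ) → ℂ) : ℂ :=
  ((L ^ 3 : ℝ) : ℂ)⁻¹ * ∫ x in cube L, f x

end TwistedPoincare

end

/-!
The inequality is proved mode by mode in Fourier space. Let `μ` be the normalised measure on the
cube, `V = ∇_φ f`, and split `V = v + w` with `w` the restriction of `V` to `S = Ωᶜ`. Writing
`q(k) = 2πk + (0, 0, φ)`, the weak derivative tested against characters gives
`L V̂(k) = i q(k) f̂(k)` (`coeff_twistedGradient`).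

For `k ≠ 0` one has `|q(k)| ≥ 2π - |φ| > |φ|` (`gap_le_freqSq`), so for `A` strictly between `φ²` and
`(2π - |φ|)²` Young's inequality yields `A |f̂(k)|² ≤ L² (|v̂(k)|² + B |q(k)|⁻² |ŵ(k)|²)`. The sum
over `k` of the first terms is controlled by Bessel's inequality, that is, by the energy in `Ω`. The
second terms are small because `w` lives on the small set `S`
(`sum_weighted_sq_coeff_le`): `∑ |q(k)|⁻² |ŵ(k)|² ≤ (∑ |q(k)|⁻⁴)^{1/2} μ(S)^{1/2} ‖w‖²`. By duality
this is a bound on the `L²(S)` norm of trigonometric polynomials; their Gram matrix has the entries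
`χ̂_S(l - k)`, and its weighted Hilbert–Schmidt norm is bounded through Parseval's identity for
`χ_S`. The series `∑ |q(k)|⁻⁴` converges in dimension three (`summable_sq_inv_freqSq`).

The mode `k = 0` must keep the sharp constant `φ²`, so Young's inequality is not available there;
instead `|v̂(0)|² ≥ |V̂(0)|² - 2 |V̂(0)| |ŵ(0)|` and `|ŵ(0)| ≤ μ(S)^{1/2} ‖w‖`. This is the term
that fixes the exponent `1/2` of the volume fraction. Summing the modes with Parseval's identity
(`hasSum_sq_coeff`) gives `poincare_of_coeff`; the theorem is its restatement in terms of Lebesgue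
measure.
-/

open scoped ComplexConjugate

namespace TwistedPoincare

/-! ### Fourier series on the cube -/

/-- The normalised Lebesgue measure on the cube, a probability measure. -/
noncomputable def cubeMeasure (L : ℝ) : Measure (Fin 3 → ℝ) :=
  (ENNReal.ofReal (L ^ 3))⁻¹ • volume.restrict (cube L)

/-- The character `x ↦ exp (2πi k · x / L)` of the torus of side `L`. -/
noncomputable def character (L : ℝ) (k : Fin 3 → ℤ) (x : Fin 3 → ℝ) : ℂ :=
  Complex.exp (2 * Real.pi * Complex.I * ∑ j, (k j : ℂ) * ((x j : ℂ) / L))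

/-- The Fourier coefficient `L⁻³ ∫ conj (character L k) f` of a function on the cube. -/
noncomputable def coeff (L : ℝ) (f : (Fin 3 → ℝ) → ℂ) (k : Fin 3 → ℤ) : ℂ :=
  ∫ x, conj (character L k x) * f x ∂cubeMeasure L

theorem volume_cube {L : ℝ} (hL : 0 < L) : volume (cube L) = ENNReal.ofReal (L ^ 3) := by
  rw [cube, Real.volume_Icc_pi]
  simp [ENNReal.ofReal_pow hL.le]

theorem isProbabilityMeasure_cubeMeasure {L : ℝ} (hL : 0 < L) :
    IsProbabilityMeasure (cubeMeasure L) := by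
  constructor
  rw [cubeMeasure, Measure.smul_apply, Measure.restrict_apply_univ, volume_cube hL, smul_eq_mul]
  exact ENNReal.inv_mul_cancel (by simpa using by positivity) (by simp)

theorem continuous_character (L : ℝ) (k : Fin 3 → ℤ) : Continuous (character L k) := by
  unfold character
  fun_prop

/-- The representative in `(0, L]³` of a point of the standard torus, rescaled by `L`. -/
noncomputable def torusLift (L : ℝ) (t : UnitAddTorus (Fin 3)) : Fin 3 → ℝ :=
  L • (UnitAddTorus.measurableEquivPiIoc (0 : Fin 3 → ℝ) t).1

theorem mFourier_eq_character_torusLift {L : ℝ} (hL : 0 < L) (k : Fin 3 → ℤ)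
    (t : UnitAddTorus (Fin 3)) : UnitAddTorus.mFourier k t = character L k (torusLift L t) := by
  have ht : ∀ j, t j = (((AddCircle.equivIoc 1 (0 : ℝ) (t j)).1 : ℝ) : UnitAddCircle) := fun j =>
    ((AddCircle.equivIoc 1 (0 : ℝ)).symm_apply_apply (t j)).symm
  simp only [UnitAddTorus.mFourier, ContinuousMap.coe_mk, character, torusLift]
  rw [Finset.mul_sum, Complex.exp_sum]
  refine Finset.prod_congr rfl fun j _ => ?_
  conv_lhs => rw [ht j]
  rw [fourier_coe_apply]
  congr 1
  have : (L : ℂ) ≠ 0 := by exact_mod_cast hL.ne'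
  simp
  field_simp

/-- The Haar probability measure on the standard torus, in the form of Mathlib's theory of
multivariate Fourier series. It is not `volume`, whose instance on the circle is another term. -/
noncomputable def torusMeasure : Measure (UnitAddTorus (Fin 3)) :=
  Measure.pi fun _ => AddCircle.haarAddCircle

theorem measurePreserving_torusLift {L : ℝ} (hL : 0 < L) :
    MeasurePreserving (torusLift L) torusMeasure (cubeMeasure L) := by
  have h1 : MeasurePreserving (UnitAddTorus.measurableEquivPiIoc (0 : Fin 3 → ℝ)) torusMeasure
      (Measure.comap Subtype.val volume) := UnitAddTorus.measurePreserving_equivPiIoc 0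
  have hms : MeasurableSet {x : Fin 3 → ℝ |
      ∀ i, x i ∈ Set.Ioc ((0 : Fin 3 → ℝ) i) ((0 : Fin 3 → ℝ) i + 1)} :=
    MeasurableSet.univ_pi' fun i => measurableSet_Ioc
  have h2 : MeasurePreserving
      (Subtype.val : {x : Fin 3 → ℝ //
        ∀ i, x i ∈ Set.Ioc ((0 : Fin 3 → ℝ) i) ((0 : Fin 3 → ℝ) i + 1)} → _)
      (Measure.comap Subtype.val volume) (volume.restrict _) :=
    ⟨measurable_subtype_coe, map_comap_subtype_coe hms volume⟩
  have h3 : MeasurePreserving (fun x : Fin 3 → ℝ => L • x) (volume.restrict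
      {x : Fin 3 → ℝ | ∀ i, x i ∈ Set.Ioc ((0 : Fin 3 → ℝ) i) ((0 : Fin 3 → ℝ) i + 1)})
      (cubeMeasure L) := by
    have hpre : {x : Fin 3 → ℝ | ∀ i, x i ∈ Set.Ioc ((0 : Fin 3 → ℝ) i) ((0 : Fin 3 → ℝ) i + 1)}
        =ᵐ[volume] (fun x : Fin 3 → ℝ => L • x) ⁻¹' cube L := by
      have h := Measure.univ_pi_Ioc_ae_eq_Icc (μ := fun _ : Fin 3 => (volume : Measure ℝ))
        (f := 0) (g := fun _ => (1 : ℝ))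
      have e1 : {x : Fin 3 → ℝ | ∀ i, x i ∈ Set.Ioc ((0 : Fin 3 → ℝ) i) ((0 : Fin 3 → ℝ) i + 1)}
          = Set.univ.pi fun _ => Set.Ioc 0 1 := by ext x; simp
      have e2 : (fun x : Fin 3 → ℝ => L • x) ⁻¹' cube L = Set.Icc 0 fun _ => (1 : ℝ) := by
        ext x
        simp only [cube, Set.mem_preimage, Set.mem_Icc, Pi.le_def, Pi.smul_apply, smul_eq_mul,
          Pi.zero_apply]
        refine and_congr (forall_congr' fun j => ?_) (forall_congr' fun j => ?_)
        · exact mul_nonneg_iff_of_pos_left hL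
        · exact mul_le_iff_le_one_right hL
      rw [e1, e2]
      exact h
    refine ⟨measurable_const_smul L, ?_⟩
    rw [Measure.restrict_congr_set hpre, ← Measure.restrict_map (measurable_const_smul L)
      (show MeasurableSet (cube L) from measurableSet_Icc), Measure.map_addHaar_smul _ hL.ne',
      Measure.restrict_smul, cubeMeasure]
    congr 1
    rw [← ENNReal.ofReal_inv_of_pos (by positivity), abs_of_pos (by positivity)]
    simp
  exact h3.comp (h2.comp h1)

/-- Parseval's identity on the cube. -/
theorem hasSum_sq_coeff {L : ℝ} (hL : 0 < L) {f : (Fin 3 → ℝ) → ℂ}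
    (hf : MemLp f 2 (cubeMeasure L)) :
    HasSum (fun k => ‖coeff L f k‖ ^ 2) (∫ x, ‖f x‖ ^ 2 ∂cubeMeasure L) := by
  have hR := measurePreserving_torusLift hL
  have hF : MemLp (f ∘ torusLift L) 2 torusMeasure := hf.comp_measurePreserving hR
  have key := UnitAddTorus.hasSum_sq_mFourierCoeff (d := Fin 3) (hF.toLp (f ∘ torusLift L))
  have hae : hF.toLp (f ∘ torusLift L) =ᵐ[torusMeasure] f ∘ torusLift L := hF.coeFn_toLp
  have hmap : ∀ {E : Type} [NormedAddCommGroup E] [NormedSpace ℝ E] {g : (Fin 3 → ℝ) → E},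
      AEStronglyMeasurable g (cubeMeasure L) →
      ∫ t, g (torusLift L t) ∂torusMeasure = ∫ x, g x ∂cubeMeasure L := by
    intro E _ _ g hg
    rw [← hR.map_eq] at hg ⊢
    rw [integral_map hR.measurable.aemeasurable hg]
  convert! key using 1
  · funext k
    congr 2
    rw [UnitAddTorus.mFourierCoeff, coeff, ← hmap ?_]
    · refine integral_congr_ae (hae.mono fun t ht => ?_)
      simp only [smul_eq_mul]
      rw [UnitAddTorus.mFourier_neg, mFourier_eq_character_torusLift hL]
      exact congrArg _ ht.symm
    · exact ((Complex.continuous_conj.comp (continuous_character L k)).aestronglyMeasurable).mul hf.1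
  · refine (hmap (g := fun x => ‖f x‖ ^ 2) (hf.1.norm.pow 2)).symm.trans ?_
    refine integral_congr_ae (hae.mono fun t ht => ?_)
    exact congrArg (fun z : ℂ => ‖z‖ ^ 2) ht.symm

/-! ### Characters and weak derivatives -/

theorem norm_character (L : ℝ) (k : Fin 3 → ℤ) (x : Fin 3 → ℝ) : ‖character L k x‖ = 1 := by
  have : (2 * Real.pi * Complex.I * ∑ j, (k j : ℂ) * ((x j : ℂ) / L))
      = ((2 * Real.pi * ∑ j, (k j : ℝ) * (x j / L) : ℝ) : ℂ) * Complex.I := by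
    push_cast
    ring
  rw [character, this, Complex.norm_exp_ofReal_mul_I]

theorem conj_character (L : ℝ) (k : Fin 3 → ℤ) (x : Fin 3 → ℝ) :
    conj (character L k x) = character L (-k) x := by
  simp only [character, ← Complex.exp_conj, map_mul, map_sum, map_div₀, Complex.conj_I,
    Complex.conj_ofReal, map_ofNat, Pi.neg_apply, Int.cast_neg, neg_mul, Finset.sum_neg_distrib,
    map_intCast, mul_neg]

theorem character_mul (L : ℝ) (k l : Fin 3 → ℤ) (x : Fin 3 → ℝ) :
    character L k x * character L l x = character L (k + l) x := by
  simp only [character, ← Complex.exp_add, ← mul_add, ← Finset.sum_add_distrib, Pi.add_apply,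
    Int.cast_add, add_mul]

theorem character_zero (L : ℝ) (x : Fin 3 → ℝ) : character L 0 x = 1 := by
  simp [character]

theorem isPeriodicSmooth_character {L : ℝ} (hL : 0 < L) (k : Fin 3 → ℤ) :
    IsPeriodicSmooth L (character L k) := by
  constructor
  · unfold character
    have : ∀ j, ContDiff ℝ ∞ fun x : Fin 3 → ℝ => (x j : ℂ) := fun j =>
      Complex.ofRealCLM.contDiff.comp (contDiff_apply ℝ ℝ j)
    exact (contDiff_const.mul (ContDiff.sum fun j _ =>
      contDiff_const.mul ((this j).div_const _))).cexp
  · intro j x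
    have hL' : (L : ℂ) ≠ 0 := by exact_mod_cast hL.ne'
    have : (2 * Real.pi * Complex.I * ∑ i,
          (k i : ℂ) * ((((x + Pi.single j L : Fin 3 → ℝ) i : ℝ) : ℂ) / L))
        = 2 * Real.pi * Complex.I * (∑ i, (k i : ℂ) * ((x i : ℂ) / L))
          + k j * (2 * Real.pi * Complex.I) := by
      have h : ∀ i, (k i : ℂ) * ((((x + Pi.single j L : Fin 3 → ℝ) i : ℝ) : ℂ) / L)
          = (k i : ℂ) * ((x i : ℂ) / L) + if i = j then (k i : ℂ) else 0 := by
        intro i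
        by_cases hij : i = j
        · subst hij
          simp
          field_simp
        · simp [hij]
      rw [Finset.sum_congr rfl fun i _ => h i, Finset.sum_add_distrib]
      simp
      ring
    rw [character, this, Complex.exp_add, Complex.exp_int_mul_two_pi_mul_I, mul_one, character]

theorem fderiv_character (L : ℝ) (k : Fin 3 → ℤ) (x : Fin 3 → ℝ) (j : Fin 3) :
    fderiv ℝ (character L k) x (Pi.single j 1)
      = 2 * Real.pi * Complex.I * k j / L * character L k x := by
  have h1 : ∀ i, HasFDerivAt (fun x : Fin 3 → ℝ => (x i : ℂ))
      (Complex.ofRealCLM.comp (ContinuousLinearMap.proj (R := ℝ) (φ := fun _ : Fin 3 => ℝ) i)) x :=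
    fun i => ContinuousLinearMap.hasFDerivAt (Complex.ofRealCLM.comp
      (ContinuousLinearMap.proj (R := ℝ) (φ := fun _ : Fin 3 => ℝ) i))
  have h2 := ((HasFDerivAt.fun_sum (u := Finset.univ) fun i _ =>
    ((h1 i).mul_const (L : ℂ)⁻¹).const_mul (k i : ℂ)).const_mul (2 * Real.pi * Complex.I)).cexp
  simp only [← div_eq_mul_inv] at h2
  have h3 : HasFDerivAt (character L k) _ x := h2
  rw [h3.fderiv]
  simp [Pi.single_apply, character, apply_ite (fun r : ℝ => (r : ℂ))]
  ring

theorem integral_cubeMeasure {L : ℝ} (hL : 0 < L) {E : Type*} [NormedAddCommGroup E]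
    [NormedSpace ℝ E] (g : (Fin 3 → ℝ) → E) :
    ∫ x, g x ∂cubeMeasure L = (L ^ 3)⁻¹ • ∫ x in cube L, g x := by
  rw [cubeMeasure, integral_smul_measure, ENNReal.toReal_inv,
    ENNReal.toReal_ofReal (by positivity)]

theorem memLp_cubeMeasure {L : ℝ} (hL : 0 < L) {f : (Fin 3 → ℝ) → ℂ}
    (hf : MemLp f 2 (volume.restrict (cube L))) : MemLp f 2 (cubeMeasure L) :=
  hf.smul_measure (ENNReal.inv_ne_top.2 (by simpa using by positivity))

/-- Passing to the weak gradient multiplies the Fourier coefficients by `2πi k / L`. -/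
theorem coeff_weakPartial {L : ℝ} (hL : 0 < L) {f g : (Fin 3 → ℝ) → ℂ} {j : Fin 3}
    (h : HasWeakPartial L f j g) (k : Fin 3 → ℤ) :
    coeff L g k = 2 * Real.pi * Complex.I * k j / L * coeff L f k := by
  have h1 := h _ (isPeriodicSmooth_character hL (-k))
  simp only [fderiv_character] at h1
  have h2 : ∀ u : (Fin 3 → ℝ) → ℂ, coeff L u k
      = (L ^ 3)⁻¹ • ∫ x in cube L, u x * character L (-k) x := by
    intro u
    rw [coeff, integral_cubeMeasure hL]
    simp only [conj_character, mul_comm]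
  have h3 : ∫ x in cube L, f x * (2 * Real.pi * Complex.I * ((-k) j : ℤ) / L * character L (-k) x)
      = -(2 * Real.pi * Complex.I * k j / L) * ∫ x in cube L, f x * character L (-k) x := by
    rw [← integral_const_mul]
    congr 1
    funext x
    simp
    ring
  rw [h3, eq_comm, neg_eq_iff_eq_neg] at h1
  rw [h2, h2, h1]
  simp only [Complex.real_smul]
  ring

theorem integrable_conj_character_mul {μ : Measure (Fin 3 → ℝ)} {f : (Fin 3 → ℝ) → ℂ}
    (L : ℝ) (hf : Integrable f μ) (k : Fin 3 → ℤ) :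
    Integrable (fun x => conj (character L k x) * f x) μ :=
  hf.bdd_mul (c := 1)
    (Complex.continuous_conj.comp (continuous_character L k)).aestronglyMeasurable
    (Filter.Eventually.of_forall fun x => by simp [norm_character])

theorem coeff_add {L : ℝ} {f g : (Fin 3 → ℝ) → ℂ} (hf : Integrable f (cubeMeasure L))
    (hg : Integrable g (cubeMeasure L)) (k : Fin 3 → ℤ) :
    coeff L (fun x => f x + g x) k = coeff L f k + coeff L g k := by
  simp only [coeff, mul_add]
  exact integral_add (integrable_conj_character_mul L hf k) (integrable_conj_character_mul L hg k)

theorem coeff_const_mul (L : ℝ) (a : ℂ) (f : (Fin 3 → ℝ) → ℂ) (k : Fin 3 → ℤ) :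
    coeff L (fun x => a * f x) k = a * coeff L f k := by
  simp only [coeff, ← integral_const_mul]
  congr 1
  funext x
  ring

theorem coeff_zero_eq_mean {L : ℝ} (hL : 0 < L) (f : (Fin 3 → ℝ) → ℂ) :
    coeff L f 0 = mean L f := by
  simp only [coeff, character_zero, map_one, one_mul]
  rw [integral_cubeMeasure hL, mean, Complex.real_smul]
  push_cast
  rfl

/-! ### Fourier coefficients of functions with small support -/

theorem sq_integral_mul_le {α : Type*} [MeasurableSpace α] {μ : Measure α} {u v : α → ℝ}
    (hu : MemLp u 2 μ) (hv : MemLp v 2 μ) (hu0 : ∀ x, 0 ≤ u x) (hv0 : ∀ x, 0 ≤ v x) :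
    (∫ x, u x * v x ∂μ) ^ 2 ≤ (∫ x, u x ^ 2 ∂μ) * ∫ x, v x ^ 2 ∂μ := by
  have h := integral_mul_le_Lp_mul_Lq_of_nonneg (μ := μ) Real.HolderConjugate.two_two
    (Filter.Eventually.of_forall hu0) (Filter.Eventually.of_forall hv0)
    (by simpa using hu) (by simpa using hv)
  simp only [Real.rpow_two, ← Real.sqrt_eq_rpow] at h
  have h0 : 0 ≤ ∫ x, u x * v x ∂μ := integral_nonneg fun x => mul_nonneg (hu0 x) (hv0 x)
  have h1 : 0 ≤ ∫ x, u x ^ 2 ∂μ := integral_nonneg fun x => sq_nonneg _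
  have h2 : 0 ≤ ∫ x, v x ^ 2 ∂μ := integral_nonneg fun x => sq_nonneg _
  calc _ ≤ (√(∫ x, u x ^ 2 ∂μ) * √(∫ x, v x ^ 2 ∂μ)) ^ 2 := pow_le_pow_left₀ h0 h 2
    _ = _ := by rw [mul_pow, Real.sq_sqrt h1, Real.sq_sqrt h2]

/-- The indicator function of `S` as a complex function. -/
noncomputable def setIndicator (S : Set (Fin 3 → ℝ)) : (Fin 3 → ℝ) → ℂ :=
  S.indicator fun _ => 1

theorem hasSum_sq_coeff_setIndicator {L : ℝ} (hL : 0 < L) {S : Set (Fin 3 → ℝ)}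
    (hS : NullMeasurableSet S (cubeMeasure L)) :
    HasSum (fun k => ‖coeff L (setIndicator S) k‖ ^ 2) ((cubeMeasure L).real S) := by
  have := isProbabilityMeasure_cubeMeasure hL
  have hm : MemLp (setIndicator S) 2 (cubeMeasure L) :=
    MemLp.of_bound (aestronglyMeasurable_const.indicator₀ hS) 1
      (Filter.Eventually.of_forall fun x => by
        by_cases hx : x ∈ S <;> simp [setIndicator, hx])
  convert hasSum_sq_coeff hL hm using 1
  have h : (fun x => ‖setIndicator S x‖ ^ 2) = S.indicator fun _ => (1 : ℝ) := by
    funext x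
    by_cases hx : x ∈ S <;> simp [setIndicator, hx]
  rw [h, integral_indicator₀ hS]
  simp [Measure.real]

/-- The `L²(S)` norm of a trigonometric polynomial, bounded through its Gram matrix, whose
entries are Fourier coefficients of the indicator function of `S`. -/
theorem setIntegral_normSq_trigPolynomial_le {L : ℝ} (hL : 0 < L) {S : Set (Fin 3 → ℝ)}
    (hS : NullMeasurableSet S (cubeMeasure L)) (K : Finset (Fin 3 → ℤ)) (c : (Fin 3 → ℤ) → ℂ) :
    ∫ x in S, ‖∑ k ∈ K, c k * character L k x‖ ^ 2 ∂cubeMeasure L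
      ≤ ∑ p ∈ K ×ˢ K, ‖c p.1‖ * ‖c p.2‖ * ‖coeff L (setIndicator S) (p.2 - p.1)‖ := by
  have := isProbabilityMeasure_cubeMeasure hL
  have hint : ∀ k, Integrable (character L k) ((cubeMeasure L).restrict S) := fun k =>
    Integrable.of_bound (continuous_character L k).aestronglyMeasurable 1
      (Filter.Eventually.of_forall fun x => (norm_character L k x).le)
  have hχ : ∀ k l, ∫ x in S, character L (k - l) x ∂cubeMeasure L
      = coeff L (setIndicator S) (l - k) := by
    intro k l
    rw [coeff, ← integral_indicator₀ hS]
    congr 1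
    funext x
    rw [conj_character, neg_sub]
    by_cases hx : x ∈ S <;> simp [setIndicator, hx]
  have hexp : ∀ x, ((‖∑ k ∈ K, c k * character L k x‖ ^ 2 : ℝ) : ℂ)
      = ∑ p ∈ K ×ˢ K, c p.1 * conj (c p.2) * character L (p.1 - p.2) x := by
    intro x
    rw [Complex.ofReal_pow, ← Complex.mul_conj', map_sum, Finset.sum_mul_sum,
      ← Finset.sum_product']
    refine Finset.sum_congr rfl fun p _ => ?_
    rw [map_mul, conj_character, sub_eq_add_neg, ← character_mul]
    ring
  have hI : ((∫ x in S, ‖∑ k ∈ K, c k * character L k x‖ ^ 2 ∂cubeMeasure L : ℝ) : ℂ)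
      = ∑ p ∈ K ×ˢ K, c p.1 * conj (c p.2) * coeff L (setIndicator S) (p.2 - p.1) := by
    rw [← integral_complex_ofReal]
    simp only [hexp]
    rw [integral_finsetSum _ fun p _ => (hint _).const_mul _]
    simp only [integral_const_mul, hχ]
  calc _ = ‖((∫ x in S, ‖∑ k ∈ K, c k * character L k x‖ ^ 2 ∂cubeMeasure L : ℝ) : ℂ)‖ := by
        rw [Complex.norm_real, Real.norm_of_nonneg (integral_nonneg fun x => sq_nonneg _)]
    _ ≤ _ := by
        rw [hI]
        refine (norm_sum_le _ _).trans_eq (Finset.sum_congr rfl fun p _ => ?_)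
        simp

/-- The Gram matrix of the functions `√(a k) • character L k` in `L²(S)` has Hilbert–Schmidt norm
at most the `ℓ²` norm of `a` times `|S|^{1/2}`; this is the square of that bound. -/
theorem sum_weighted_coeff_setIndicator_le {L : ℝ} (hL : 0 < L) {S : Set (Fin 3 → ℝ)}
    (hS : NullMeasurableSet S (cubeMeasure L)) (K : Finset (Fin 3 → ℤ)) (a : (Fin 3 → ℤ) → ℝ) :
    ∑ p ∈ K ×ˢ K, a p.1 * a p.2 * ‖coeff L (setIndicator S) (p.2 - p.1)‖ ^ 2
      ≤ (∑ k ∈ K, a k ^ 2) * (cubeMeasure L).real S := by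
  have hsum := hasSum_sq_coeff_setIndicator hL hS
  have h1 : ∀ k, ∑ l ∈ K, ‖coeff L (setIndicator S) (l - k)‖ ^ 2 ≤ (cubeMeasure L).real S :=
    fun k => sum_le_hasSum K (fun l _ => sq_nonneg _) ((Equiv.subRight k).hasSum_iff.2 hsum)
  have h2 : ∀ l, ∑ k ∈ K, ‖coeff L (setIndicator S) (l - k)‖ ^ 2 ≤ (cubeMeasure L).real S :=
    fun l => sum_le_hasSum K (fun k _ => sq_nonneg _) ((Equiv.subLeft l).hasSum_iff.2 hsum)
  calc _ ≤ ∑ p ∈ K ×ˢ K, (a p.1 ^ 2 / 2 * ‖coeff L (setIndicator S) (p.2 - p.1)‖ ^ 2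
        + a p.2 ^ 2 / 2 * ‖coeff L (setIndicator S) (p.2 - p.1)‖ ^ 2) := by
        refine Finset.sum_le_sum fun p _ => ?_
        rw [← add_mul]
        exact mul_le_mul_of_nonneg_right (by nlinarith [sq_nonneg (a p.1 - a p.2)])
          (sq_nonneg _)
    _ = ∑ k ∈ K, a k ^ 2 / 2 * ∑ l ∈ K, ‖coeff L (setIndicator S) (l - k)‖ ^ 2
        + ∑ l ∈ K, a l ^ 2 / 2 * ∑ k ∈ K, ‖coeff L (setIndicator S) (l - k)‖ ^ 2 := by
        simp only [Finset.mul_sum]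
        rw [Finset.sum_add_distrib, Finset.sum_product, Finset.sum_product_right]
    _ ≤ ∑ k ∈ K, a k ^ 2 / 2 * (cubeMeasure L).real S
        + ∑ l ∈ K, a l ^ 2 / 2 * (cubeMeasure L).real S :=
        add_le_add
          (Finset.sum_le_sum fun k _ => mul_le_mul_of_nonneg_left (h1 k) (by positivity))
          (Finset.sum_le_sum fun l _ => mul_le_mul_of_nonneg_left (h2 l) (by positivity))
    _ = _ := by
        rw [← Finset.sum_add_distrib, Finset.sum_mul]
        exact Finset.sum_congr rfl fun k _ => by ring

/-- A function supported in a small set has small Fourier coefficients in every weighted `ℓ²`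
norm with square-summable weights. -/
theorem sum_weighted_sq_coeff_le {L : ℝ} (hL : 0 < L) {S : Set (Fin 3 → ℝ)}
    (hS : NullMeasurableSet S (cubeMeasure L)) {w : (Fin 3 → ℝ) → ℂ}
    (hw : MemLp w 2 (cubeMeasure L)) (hwS : ∀ x ∉ S, w x = 0) (K : Finset (Fin 3 → ℤ))
    {a : (Fin 3 → ℤ) → ℝ} (ha : ∀ k, 0 ≤ a k) :
    ∑ k ∈ K, a k * ‖coeff L w k‖ ^ 2
      ≤ √((∑ k ∈ K, a k ^ 2) * (cubeMeasure L).real S) * ∫ x, ‖w x‖ ^ 2 ∂cubeMeasure L := by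
  have := isProbabilityMeasure_cubeMeasure hL
  set X := ∑ k ∈ K, a k * ‖coeff L w k‖ ^ 2 with hX
  set m := √((∑ k ∈ K, a k ^ 2) * (cubeMeasure L).real S) with hm
  set W := ∫ x, ‖w x‖ ^ 2 ∂cubeMeasure L with hW
  have hX0 : 0 ≤ X := Finset.sum_nonneg fun k _ => mul_nonneg (ha k) (sq_nonneg _)
  have hW0 : 0 ≤ W := integral_nonneg fun x => sq_nonneg _
  let g : (Fin 3 → ℝ) → ℂ := fun x => ∑ k ∈ K, (a k * coeff L w k) * character L k x
  have hg : Continuous g := continuous_finsetSum _ fun k _ =>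
    continuous_const.mul (continuous_character L k)
  have hwi : Integrable w (cubeMeasure L) := hw.integrable one_le_two
  -- the weighted sum is the pairing of `w` with the trigonometric polynomial `g`
  have hpair : (X : ℂ) = ∫ x, conj (g x) * w x ∂cubeMeasure L := by
    have : ∀ x, conj (g x) * w x
        = ∑ k ∈ K, (a k * conj (coeff L w k)) * (conj (character L k x) * w x) := by
      intro x
      simp only [g, map_sum, map_mul, Complex.conj_ofReal, Finset.sum_mul, mul_assoc]
    simp only [this]
    rw [integral_finsetSum _ fun k _ => (integrable_conj_character_mul L hwi k).const_mul _]
    simp only [integral_const_mul]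
    rw [hX]
    push_cast
    refine Finset.sum_congr rfl fun k _ => ?_
    rw [← Complex.mul_conj']
    simp only [coeff]
    ring
  have hgb : ∀ x, ‖g x‖ ≤ ∑ k ∈ K, ‖(a k * coeff L w k : ℂ)‖ := fun x =>
    (norm_sum_le _ _).trans_eq (Finset.sum_congr rfl fun k _ => by
      rw [norm_mul, norm_character, mul_one])
  have hgm : MemLp (S.indicator fun x => ‖g x‖) 2 (cubeMeasure L) :=
    MemLp.of_bound (hg.norm.aestronglyMeasurable.indicator₀ hS) _
      (Filter.Eventually.of_forall fun x =>
        (norm_indicator_le_norm_self _ x).trans (by simpa using hgb x))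
  have hXle : X ≤ ∫ x, (S.indicator fun x => ‖g x‖) x * ‖w x‖ ∂cubeMeasure L := by
    calc X = ‖(X : ℂ)‖ := by rw [Complex.norm_real, Real.norm_of_nonneg hX0]
      _ ≤ ∫ x, ‖conj (g x) * w x‖ ∂cubeMeasure L := by
        rw [hpair]
        exact norm_integral_le_integral_norm _
      _ = _ := by
        congr 1
        funext x
        by_cases hx : x ∈ S
        · simp [hx]
        · simp [hx, hwS x hx]
  have hCS := sq_integral_mul_le hgm hw.norm
    (fun x => Set.indicator_nonneg (fun _ _ => norm_nonneg _) x) fun x => norm_nonneg _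
  have hIS : ∫ x, (S.indicator fun x => ‖g x‖) x ^ 2 ∂cubeMeasure L ≤ X * m := by
    have e : (fun x => (S.indicator fun x => ‖g x‖) x ^ 2) = S.indicator fun x => ‖g x‖ ^ 2 := by
      funext x
      by_cases hx : x ∈ S <;> simp [hx]
    rw [e, integral_indicator₀ hS]
    refine (setIntegral_normSq_trigPolynomial_le hL hS K _).trans ?_
    refine Real.le_sqrt_of_sq_le ?_ |>.trans_eq
      (Real.sqrt_sq (mul_nonneg hX0 (Real.sqrt_nonneg _)))
    have hterm : ∀ p : (Fin 3 → ℤ) × (Fin 3 → ℤ),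
        ‖(a p.1 * coeff L w p.1 : ℂ)‖ * ‖(a p.2 * coeff L w p.2 : ℂ)‖
          * ‖coeff L (setIndicator S) (p.2 - p.1)‖
        = (√(a p.1) * ‖coeff L w p.1‖ * (√(a p.2) * ‖coeff L w p.2‖))
          * (√(a p.1) * √(a p.2) * ‖coeff L (setIndicator S) (p.2 - p.1)‖) := by
      intro p
      rw [norm_mul, norm_mul, Complex.norm_real, Complex.norm_real, Real.norm_of_nonneg (ha _),
        Real.norm_of_nonneg (ha _)]
      conv_lhs => rw [← Real.mul_self_sqrt (ha p.1), ← Real.mul_self_sqrt (ha p.2)]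
      ring
    simp only [hterm]
    refine (Finset.sum_mul_sq_le_sq_mul_sq _ _ _).trans ?_
    rw [mul_pow, hm, Real.sq_sqrt (mul_nonneg (Finset.sum_nonneg fun k _ => sq_nonneg _)
      measureReal_nonneg)]
    refine mul_le_mul ?_ ?_ (Finset.sum_nonneg fun p _ => sq_nonneg _) (sq_nonneg _)
    · rw [sq X, hX, Finset.sum_mul_sum, ← Finset.sum_product']
      refine (Finset.sum_congr rfl fun p _ => ?_).le
      rw [mul_pow, mul_pow, mul_pow, Real.sq_sqrt (ha _), Real.sq_sqrt (ha _)]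
    · refine (Finset.sum_congr rfl fun p _ => ?_).trans_le
        (sum_weighted_coeff_setIndicator_le hL hS K a)
      rw [mul_pow, mul_pow, Real.sq_sqrt (ha _), Real.sq_sqrt (ha _)]
  have hfin : X ^ 2 ≤ X * m * W :=
    (pow_le_pow_left₀ hX0 hXle 2).trans (hCS.trans (mul_le_mul_of_nonneg_right hIS hW0))
  rcases hX0.eq_or_lt with h | h
  · rw [← h]
    exact mul_nonneg (Real.sqrt_nonneg _) hW0
  · nlinarith

/-- The Cauchy–Schwarz bound on the Fourier coefficients of a function supported in `S`. -/
theorem sq_norm_coeff_le {L : ℝ} (hL : 0 < L) {S : Set (Fin 3 → ℝ)}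
    (hS : NullMeasurableSet S (cubeMeasure L)) {w : (Fin 3 → ℝ) → ℂ}
    (hw : MemLp w 2 (cubeMeasure L)) (hwS : ∀ x ∉ S, w x = 0) (k : Fin 3 → ℤ) :
    ‖coeff L w k‖ ^ 2 ≤ (cubeMeasure L).real S * ∫ x, ‖w x‖ ^ 2 ∂cubeMeasure L := by
  have := isProbabilityMeasure_cubeMeasure hL
  have hm : MemLp (S.indicator fun _ => (1 : ℝ)) 2 (cubeMeasure L) :=
    MemLp.of_bound (aestronglyMeasurable_const.indicator₀ hS) 1
      (Filter.Eventually.of_forall fun x => by by_cases hx : x ∈ S <;> simp [hx])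
  have hCS := sq_integral_mul_le hm hw.norm
    (fun x => Set.indicator_nonneg (fun _ _ => zero_le_one) x) fun x => norm_nonneg _
  have e : (fun x => (S.indicator fun _ => (1 : ℝ)) x ^ 2) = S.indicator fun _ => (1 : ℝ) := by
    funext x
    by_cases hx : x ∈ S <;> simp [hx]
  have e' : ∫ x, (S.indicator fun _ => (1 : ℝ)) x ∂cubeMeasure L = (cubeMeasure L).real S := by
    rw [integral_indicator₀ hS]
    simp [Measure.real]
  rw [e, e'] at hCS
  refine (pow_le_pow_left₀ (norm_nonneg _) ?_ 2).trans hCS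
  refine (norm_integral_le_integral_norm _).trans_eq ?_
  congr 1
  funext x
  by_cases hx : x ∈ S
  · simp [hx, norm_character]
  · simp [hx, hwS x hx]

/-! ### The frequency lattice -/

/-- The vector `2πk + (0, 0, φ)`: the operator `L ∇_φ` multiplies the `k`-th Fourier coefficient by
`i` times this vector. -/
noncomputable def freq (φ : ℝ) (k : Fin 3 → ℤ) (j : Fin 3) : ℝ :=
  2 * Real.pi * k j + phaseVector φ j

/-- The squared Euclidean length of `freq φ k`. -/
noncomputable def freqSq (φ : ℝ) (k : Fin 3 → ℤ) : ℝ := ∑ j, freq φ k j ^ 2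

theorem freqSq_nonneg (φ : ℝ) (k : Fin 3 → ℤ) : 0 ≤ freqSq φ k :=
  Finset.sum_nonneg fun _ _ => sq_nonneg _

theorem abs_phaseVector_le (φ : ℝ) (j : Fin 3) : |phaseVector φ j| ≤ |φ| := by
  fin_cases j <;> simp [phaseVector]

theorem sub_le_abs_freq (φ : ℝ) (k : Fin 3 → ℤ) (j : Fin 3) :
    2 * Real.pi * |(k j : ℝ)| - |φ| ≤ |freq φ k j| := by
  have h := abs_sub_abs_le_abs_sub (2 * Real.pi * (k j : ℝ)) (-phaseVector φ j)
  rw [abs_neg, sub_neg_eq_add, abs_mul, abs_of_pos Real.two_pi_pos] at h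
  have := abs_phaseVector_le φ j
  unfold freq
  linarith

theorem one_le_abs_intCast {n : ℤ} (hn : n ≠ 0) : (1 : ℝ) ≤ |(n : ℝ)| := by
  exact_mod_cast Int.one_le_abs hn

/-- The spectral gap above the constant mode. -/
theorem gap_le_freqSq {φ : ℝ} (hφ : |φ| < Real.pi) {k : Fin 3 → ℤ} (hk : k ≠ 0) :
    (2 * Real.pi - |φ|) ^ 2 ≤ freqSq φ k := by
  obtain ⟨j, hj⟩ := Function.ne_iff.1 hk
  have h1 := sub_le_abs_freq φ k j
  have h2 := one_le_abs_intCast hj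
  have h3 : 2 * Real.pi - |φ| ≤ |freq φ k j| := by nlinarith [Real.pi_pos]
  calc _ ≤ |freq φ k j| ^ 2 := pow_le_pow_left₀ (by linarith [Real.pi_pos]) h3 2
    _ = freq φ k j ^ 2 := sq_abs _
    _ ≤ _ := Finset.single_le_sum (f := fun j => freq φ k j ^ 2) (fun _ _ => sq_nonneg _)
      (Finset.mem_univ j)

theorem intCast_le_abs_freq {φ : ℝ} (hφ : |φ| < Real.pi) (k : Fin 3 → ℤ) (j : Fin 3) :
    |(k j : ℝ)| ≤ |freq φ k j| := by
  by_cases hj : k j = 0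
  · simp [hj]
  · have h1 := sub_le_abs_freq φ k j
    have h2 := one_le_abs_intCast hj
    nlinarith [Real.pi_gt_three]

theorem sq_norm_le_freqSq {φ : ℝ} (hφ : |φ| < Real.pi) (k : Fin 3 → ℤ) :
    ‖k‖ ^ 2 ≤ freqSq φ k := by
  obtain ⟨j, hj⟩ : ∃ j, ‖k‖ = ‖k j‖ := by
    obtain ⟨j, -, hj⟩ := Finset.exists_mem_eq_sup' Finset.univ_nonempty fun j => ‖k j‖
    refine ⟨j, le_antisymm ?_ (norm_le_pi_norm k j)⟩
    refine (pi_norm_le_iff_of_nonneg (norm_nonneg _)).2 fun i => ?_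
    rw [← hj]
    exact Finset.le_sup' (fun j => ‖k j‖) (Finset.mem_univ i)
  rw [hj, Int.norm_eq_abs]
  calc _ ≤ |freq φ k j| ^ 2 := pow_le_pow_left₀ (abs_nonneg _) (intCast_le_abs_freq hφ k j) 2
    _ = freq φ k j ^ 2 := sq_abs _
    _ ≤ _ := Finset.single_le_sum (f := fun j => freq φ k j ^ 2) (fun _ _ => sq_nonneg _)
      (Finset.mem_univ j)

theorem summable_norm_inv_pow_four : Summable fun k : Fin 3 → ℤ => ‖k‖⁻¹ ^ 4 := by
  let b := Pi.basisFun ℝ (Fin 3)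
  have hmem : ∀ k : Fin 3 → ℤ, (fun j => (k j : ℝ)) ∈ Submodule.span ℤ (Set.range b) := by
    intro k
    rw [Module.Basis.mem_span_iff_repr_mem]
    exact fun j => ⟨k j, by simp [b]⟩
  have hrank : Module.finrank ℤ (Submodule.span ℤ (Set.range b)) < 4 := by
    rw [ZLattice.rank ℝ]
    simp
  have hinj : Function.Injective fun k : Fin 3 → ℤ =>
      (⟨_, hmem k⟩ : Submodule.span ℤ (Set.range b)) := by
    intro k l h
    funext j
    exact Int.cast_injective (α := ℝ) (congrFun (congrArg Subtype.val h) j)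
  refine ((ZLattice.summable_norm_pow_inv _ 4 hrank).comp_injective hinj).congr fun k => ?_
  have : ‖fun j => (k j : ℝ)‖ = ‖k‖ := by
    simp only [Pi.norm_def]
    rfl
  simp [this]

/-- In dimension three the inverse fourth power of the frequency is summable. For `φ = 0` the term
`k = 0` has the junk value `0`. -/
theorem summable_sq_inv_freqSq {φ : ℝ} (hφ : |φ| < Real.pi) :
    Summable fun k : Fin 3 → ℤ => (freqSq φ k)⁻¹ ^ 2 := by
  refine summable_norm_inv_pow_four.of_norm_bounded_eventually ?_
  refine (Set.finite_singleton (0 : Fin 3 → ℤ)).subset fun k hk => ?_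
  by_contra h0
  refine hk ?_
  change ‖(freqSq φ k)⁻¹ ^ 2‖ ≤ ‖k‖⁻¹ ^ 4
  have hk0 : 0 < ‖k‖ := norm_pos_iff.2 h0
  rw [Real.norm_of_nonneg (sq_nonneg _), show ‖k‖⁻¹ ^ 4 = ((‖k‖ ^ 2)⁻¹) ^ 2 by field_simp]
  exact pow_le_pow_left₀ (inv_nonneg.2 (freqSq_nonneg φ k))
    (inv_anti₀ (by positivity) (sq_norm_le_freqSq hφ k)) 2

/-! ### The Poincaré inequality -/

/-- Young's inequality for `‖x + y‖²`, with a constant `G > A` in front of `‖x‖²`. -/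
theorem mul_sq_norm_add_le {A G : ℝ} (hA : 0 ≤ A) (hAG : A < G) (x y : ℂ) :
    A * ‖x + y‖ ^ 2 ≤ G * ‖x‖ ^ 2 + A * G / (G - A) * ‖y‖ ^ 2 := by
  have hGA : 0 < G - A := sub_pos.2 hAG
  have h1 : ‖x + y‖ ^ 2 ≤ (‖x‖ + ‖y‖) ^ 2 := pow_le_pow_left₀ (norm_nonneg _) (norm_add_le x y) 2
  have h2 : G * ‖x‖ ^ 2 + A * G / (G - A) * ‖y‖ ^ 2 - A * (‖x‖ + ‖y‖) ^ 2
      = ((G - A) * ‖x‖ - A * ‖y‖) ^ 2 / (G - A) := by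
    field_simp
    ring
  have h3 : 0 ≤ ((G - A) * ‖x‖ - A * ‖y‖) ^ 2 / (G - A) := by positivity
  nlinarith [mul_le_mul_of_nonneg_left h1 hA]

theorem coeff_one_of_ne_zero {L : ℝ} (hL : 0 < L) {k : Fin 3 → ℤ} (hk : k ≠ 0) :
    coeff L (fun _ => 1) k = 0 := by
  have := isProbabilityMeasure_cubeMeasure hL
  have h := hasSum_sq_coeff hL (f := fun _ => 1) (memLp_const _)
  have h0 : coeff L (fun _ => 1) 0 = 1 := by simp [coeff, character_zero]
  -- the zeroth coefficient already exhausts Parseval's identity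
  have h1 := sum_le_hasSum {0, k} (fun _ _ => sq_nonneg _) h
  rw [Finset.sum_pair hk.symm, h0] at h1
  simp only [norm_one, one_pow, integral_const, probReal_univ, smul_eq_mul, mul_one] at h1
  have h2 : ‖coeff L (fun _ => 1) k‖ ^ 2 = 0 := le_antisymm (by linarith) (sq_nonneg _)
  simpa using h2

/-- Subtracting the mean removes the zeroth Fourier coefficient and keeps the others. -/
theorem coeff_sub_mean {L : ℝ} (hL : 0 < L) {f : (Fin 3 → ℝ) → ℂ}
    (hf : Integrable f (cubeMeasure L)) (k : Fin 3 → ℤ) :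
    coeff L (fun x => f x - mean L f) k = if k = 0 then 0 else coeff L f k := by
  have := isProbabilityMeasure_cubeMeasure hL
  have h : (fun x => f x - mean L f) = fun x => f x + -mean L f * (1 : ℂ) := by
    funext x
    ring
  rw [h, coeff_add hf (integrable_const _), coeff_const_mul L _ fun _ => 1]
  split_ifs with hk
  · subst hk
    rw [coeff_zero_eq_mean hL]
    simp [coeff, character_zero]
  · rw [coeff_one_of_ne_zero hL hk]
    ring

/-- The Poincaré inequality with respect to the normalised measure, for a vector field `V` with
the Fourier coefficients of `∇_φ f`; the set `S` is the part of the cube where `V` is discarded. -/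
theorem poincare_of_coeff {φ : ℝ} (hφ : |φ| < Real.pi) {A : ℝ} (hA0 : φ ^ 2 ≤ A)
    (hAG : A < (2 * Real.pi - |φ|) ^ 2) {L : ℝ} (hL : 0 < L) {S : Set (Fin 3 → ℝ)}
    (hS : NullMeasurableSet S (cubeMeasure L)) {f : (Fin 3 → ℝ) → ℂ}
    (hf : MemLp f 2 (cubeMeasure L)) {V : Fin 3 → (Fin 3 → ℝ) → ℂ}
    (hV : ∀ j, MemLp (V j) 2 (cubeMeasure L))
    (hcoeff : ∀ j k, coeff L (V j) k = Complex.I * ((freq φ k j / L : ℝ) : ℂ) * coeff L f k) :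
    φ ^ 2 * ∫ x, ‖f x‖ ^ 2 ∂cubeMeasure L
        + (A - φ ^ 2) * ∫ x, ‖f x - mean L f‖ ^ 2 ∂cubeMeasure L
      ≤ L ^ 2 * (∑ j, ∫ x, ‖Sᶜ.indicator (V j) x‖ ^ 2 ∂cubeMeasure L
        + (2 + A * (2 * Real.pi - |φ|) ^ 2 / ((2 * Real.pi - |φ|) ^ 2 - A)
            * √(∑' k, (freqSq φ k)⁻¹ ^ 2))
          * √((cubeMeasure L).real S) * ∑ j, ∫ x, ‖V j x‖ ^ 2 ∂cubeMeasure L) := by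
  have := isProbabilityMeasure_cubeMeasure hL
  set G := (2 * Real.pi - |φ|) ^ 2 with hG
  set B := A * G / (G - A) with hB
  set M := √(∑' k, (freqSq φ k)⁻¹ ^ 2) with hM
  set s := √((cubeMeasure L).real S) with hs
  have hA : 0 ≤ A := (sq_nonneg φ).trans hA0
  have hGpos : 0 < G := hA.trans_lt hAG
  have hB0 : 0 ≤ B := div_nonneg (mul_nonneg hA hGpos.le) (sub_pos.2 hAG).le
  have hs0 : 0 ≤ s := Real.sqrt_nonneg _
  have hM0 : 0 ≤ M := Real.sqrt_nonneg _
  let v : Fin 3 → (Fin 3 → ℝ) → ℂ := fun j => Sᶜ.indicator (V j)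
  let w : Fin 3 → (Fin 3 → ℝ) → ℂ := fun j => S.indicator (V j)
  have hvm : ∀ j, MemLp (v j) 2 (cubeMeasure L) := fun j =>
    (hV j).mono ((hV j).1.indicator₀ hS.compl)
      (Filter.Eventually.of_forall fun x => norm_indicator_le_norm_self _ x)
  have hwm : ∀ j, MemLp (w j) 2 (cubeMeasure L) := fun j =>
    (hV j).mono ((hV j).1.indicator₀ hS)
      (Filter.Eventually.of_forall fun x => norm_indicator_le_norm_self _ x)
  have hwS : ∀ j, ∀ x ∉ S, w j x = 0 := fun j x hx => Set.indicator_of_notMem hx _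
  have hvw : ∀ j k, coeff L (V j) k = coeff L (v j) k + coeff L (w j) k := by
    intro j k
    rw [← coeff_add ((hvm j).integrable one_le_two) ((hwm j).integrable one_le_two)]
    congr 1
    funext x
    by_cases hx : x ∈ S <;> simp [v, w, hx]
  have hwV : ∀ j, ∫ x, ‖w j x‖ ^ 2 ∂cubeMeasure L ≤ ∫ x, ‖V j x‖ ^ 2 ∂cubeMeasure L := fun j =>
    integral_mono (hwm j).integrable_norm_pow' (hV j).integrable_norm_pow' fun x =>
      pow_le_pow_left₀ (norm_nonneg _) (norm_indicator_le_norm_self _ x) 2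
  have hE0 : ∀ j, 0 ≤ ∫ x, ‖V j x‖ ^ 2 ∂cubeMeasure L := fun j =>
    integral_nonneg fun x => sq_nonneg _
  have hnorm : ∀ j k, L ^ 2 * ‖coeff L (V j) k‖ ^ 2 = freq φ k j ^ 2 * ‖coeff L f k‖ ^ 2 := by
    intro j k
    rw [hcoeff, norm_mul, norm_mul, Complex.norm_I, Complex.norm_real, mul_pow, mul_pow,
      Real.norm_eq_abs, sq_abs]
    field_simp
  -- the nonconstant modes
  have hmode : ∀ k, k ≠ 0 → A * ‖coeff L f k‖ ^ 2
      ≤ L ^ 2 * ∑ j, (‖coeff L (v j) k‖ ^ 2 + B * ((freqSq φ k)⁻¹ * ‖coeff L (w j) k‖ ^ 2)) := by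
    intro k hk
    have hQ : G ≤ freqSq φ k := gap_le_freqSq hφ hk
    have hQ0 : 0 < freqSq φ k := hGpos.trans_le hQ
    have h1 : freqSq φ k * ‖coeff L f k‖ ^ 2 = L ^ 2 * ∑ j, ‖coeff L (V j) k‖ ^ 2 := by
      rw [freqSq, Finset.sum_mul, Finset.mul_sum]
      exact Finset.sum_congr rfl fun j _ => (hnorm j k).symm
    have h2 : A * ‖coeff L f k‖ ^ 2
        = L ^ 2 * ∑ j, (freqSq φ k)⁻¹ * (A * ‖coeff L (V j) k‖ ^ 2) := by
      rw [← Finset.mul_sum, ← Finset.mul_sum]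
      field_simp
      linear_combination A * h1
    rw [h2]
    refine mul_le_mul_of_nonneg_left (Finset.sum_le_sum fun j _ => ?_) (sq_nonneg L)
    calc _ ≤ (freqSq φ k)⁻¹ * (G * ‖coeff L (v j) k‖ ^ 2 + B * ‖coeff L (w j) k‖ ^ 2) := by
          refine mul_le_mul_of_nonneg_left ?_ (inv_nonneg.2 hQ0.le)
          rw [hvw]
          exact mul_sq_norm_add_le hA hAG _ _
      _ = (freqSq φ k)⁻¹ * G * ‖coeff L (v j) k‖ ^ 2
          + B * ((freqSq φ k)⁻¹ * ‖coeff L (w j) k‖ ^ 2) := by ring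
      _ ≤ _ := by
          refine add_le_add_left (mul_le_of_le_one_left (sq_nonneg _) ?_) _
          exact (inv_mul_le_one₀ hQ0).2 hQ
  -- the constant mode, whose energy has the sharp constant `φ²`
  have hzero : φ ^ 2 * ‖coeff L f 0‖ ^ 2 ≤ L ^ 2 * (∑ j, ‖coeff L (v j) 0‖ ^ 2
      + 2 * s * ∑ j, ∫ x, ‖V j x‖ ^ 2 ∂cubeMeasure L) := by
    have h1 : φ ^ 2 * ‖coeff L f 0‖ ^ 2 = L ^ 2 * ‖coeff L (V 2) 0‖ ^ 2 := by
      rw [hnorm]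
      simp [freq, phaseVector]
    rw [h1]
    refine mul_le_mul_of_nonneg_left ?_ (sq_nonneg L)
    set N := √(∫ x, ‖V 2 x‖ ^ 2 ∂cubeMeasure L) with hN
    have hN2 : N ^ 2 = ∫ x, ‖V 2 x‖ ^ 2 ∂cubeMeasure L := Real.sq_sqrt (hE0 2)
    have h2 : ‖coeff L (V 2) 0‖ ≤ N :=
      Real.le_sqrt_of_sq_le (le_hasSum (hasSum_sq_coeff hL (hV 2)) 0 fun _ _ => sq_nonneg _)
    have h3 : ‖coeff L (w 2) 0‖ ≤ s * N := by
      rw [hs, hN, ← Real.sqrt_mul measureReal_nonneg]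
      exact Real.le_sqrt_of_sq_le ((sq_norm_coeff_le hL hS (hwm 2) (hwS 2) 0).trans
        (mul_le_mul_of_nonneg_left (hwV 2) measureReal_nonneg))
    have h4 : ‖coeff L (V 2) 0‖ - ‖coeff L (w 2) 0‖ ≤ ‖coeff L (v 2) 0‖ := by
      rw [hvw, sub_le_iff_le_add]
      exact norm_add_le _ _
    have h5 : ‖coeff L (V 2) 0‖ ^ 2
        ≤ ‖coeff L (v 2) 0‖ ^ 2 + 2 * (‖coeff L (V 2) 0‖ * ‖coeff L (w 2) 0‖) := by
      have := norm_nonneg (coeff L (v 2) 0)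
      have := norm_nonneg (coeff L (w 2) 0)
      have := norm_nonneg (coeff L (V 2) 0)
      rcases le_total ‖coeff L (V 2) 0‖ ‖coeff L (w 2) 0‖ with h | h
      · nlinarith
      · nlinarith [pow_le_pow_left₀ (sub_nonneg.2 h) h4 2]
    have h6 : ‖coeff L (V 2) 0‖ * ‖coeff L (w 2) 0‖ ≤ N * (s * N) :=
      mul_le_mul h2 h3 (norm_nonneg _) (Real.sqrt_nonneg _)
    have h7 : ‖coeff L (v 2) 0‖ ^ 2 ≤ ∑ j, ‖coeff L (v j) 0‖ ^ 2 :=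
      Finset.single_le_sum (f := fun j => ‖coeff L (v j) 0‖ ^ 2) (fun _ _ => sq_nonneg _)
        (Finset.mem_univ 2)
    have h8 : ∫ x, ‖V 2 x‖ ^ 2 ∂cubeMeasure L ≤ ∑ j, ∫ x, ‖V j x‖ ^ 2 ∂cubeMeasure L :=
      Finset.single_le_sum (f := fun j => ∫ x, ‖V j x‖ ^ 2 ∂cubeMeasure L) (fun j _ => hE0 j)
        (Finset.mem_univ 2)
    have h9 : N * (s * N) ≤ s * ∑ j, ∫ x, ‖V j x‖ ^ 2 ∂cubeMeasure L := by
      rw [show N * (s * N) = s * N ^ 2 by ring, hN2]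
      exact mul_le_mul_of_nonneg_left h8 hs0
    linarith
  have hsumf := hasSum_sq_coeff hL hf
  have hsumh := hasSum_sq_coeff hL (f := fun x => f x - mean L f) (hf.sub (memLp_const _))
  simp only [coeff_sub_mean hL (hf.integrable one_le_two)] at hsumh
  refine hasSum_le_of_sum_le ((hsumf.mul_left (φ ^ 2)).add (hsumh.mul_left (A - φ ^ 2)))
    fun K => ?_
  have hterm0 : ∀ k, 0 ≤ φ ^ 2 * ‖coeff L f k‖ ^ 2
      + (A - φ ^ 2) * ‖if k = 0 then 0 else coeff L f k‖ ^ 2 := fun k =>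
    add_nonneg (mul_nonneg (sq_nonneg _) (sq_nonneg _))
      (mul_nonneg (sub_nonneg.2 hA0) (sq_nonneg _))
  have hKsub : K ⊆ insert 0 (K.erase 0) := Finset.subset_insert_iff.2 subset_rfl
  refine (Finset.sum_le_sum_of_subset_of_nonneg hKsub fun k _ _ => hterm0 k).trans ?_
  rw [Finset.sum_insert (Finset.notMem_erase 0 K)]
  have hrest : ∑ k ∈ K.erase 0, (φ ^ 2 * ‖coeff L f k‖ ^ 2
        + (A - φ ^ 2) * ‖if k = 0 then 0 else coeff L f k‖ ^ 2)
      ≤ L ^ 2 * ∑ j, (∑ k ∈ K.erase 0, ‖coeff L (v j) k‖ ^ 2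
        + B * ∑ k ∈ K.erase 0, (freqSq φ k)⁻¹ * ‖coeff L (w j) k‖ ^ 2) := by
    simp only [Finset.mul_sum, ← Finset.sum_add_distrib]
    rw [Finset.sum_comm]
    refine Finset.sum_le_sum fun k hk => ?_
    have hk0 := Finset.ne_of_mem_erase hk
    have := hmode k hk0
    rw [Finset.mul_sum] at this
    rw [if_neg hk0]
    linarith
  have hbessel : ∀ j, ‖coeff L (v j) 0‖ ^ 2 + ∑ k ∈ K.erase 0, ‖coeff L (v j) k‖ ^ 2
      ≤ ∫ x, ‖v j x‖ ^ 2 ∂cubeMeasure L := by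
    intro j
    rw [← Finset.sum_insert (f := fun k => ‖coeff L (v j) k‖ ^ 2) (Finset.notMem_erase 0 K)]
    exact sum_le_hasSum _ (fun _ _ => sq_nonneg _) (hasSum_sq_coeff hL (hvm j))
  have hsmall : ∀ j, ∑ k ∈ K.erase 0, (freqSq φ k)⁻¹ * ‖coeff L (w j) k‖ ^ 2
      ≤ M * s * ∫ x, ‖V j x‖ ^ 2 ∂cubeMeasure L := by
    intro j
    refine (sum_weighted_sq_coeff_le hL hS (hwm j) (hwS j) _ fun k =>
      inv_nonneg.2 (freqSq_nonneg φ k)).trans ?_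
    refine mul_le_mul ?_ (hwV j) (integral_nonneg fun x => sq_nonneg _) (mul_nonneg hM0 hs0)
    rw [hM, hs, ← Real.sqrt_mul (tsum_nonneg fun _ => sq_nonneg _)]
    exact Real.sqrt_le_sqrt (mul_le_mul_of_nonneg_right
      ((summable_sq_inv_freqSq hφ).sum_le_tsum _ fun _ _ => sq_nonneg _) measureReal_nonneg)
  have hall : ∑ j, (‖coeff L (v j) 0‖ ^ 2 + (∑ k ∈ K.erase 0, ‖coeff L (v j) k‖ ^ 2
        + B * ∑ k ∈ K.erase 0, (freqSq φ k)⁻¹ * ‖coeff L (w j) k‖ ^ 2))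
      ≤ ∑ j, (∫ x, ‖v j x‖ ^ 2 ∂cubeMeasure L
        + B * (M * s * ∫ x, ‖V j x‖ ^ 2 ∂cubeMeasure L)) := by
    refine Finset.sum_le_sum fun j _ => ?_
    have := mul_le_mul_of_nonneg_left (hsmall j) hB0
    linarith [hbessel j]
  rw [Finset.sum_add_distrib, Finset.sum_add_distrib (f := fun j => ∫ x, ‖v j x‖ ^ 2 ∂_),
    ← Finset.mul_sum, ← Finset.mul_sum] at hall
  have hall' := mul_le_mul_of_nonneg_left hall (sq_nonneg L)
  simp only [if_true, norm_zero]
  simp only [v] at hall' hzero hrest ⊢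
  linarith

theorem coeff_twistedGradient {φ L : ℝ} (hL : 0 < L) {f : (Fin 3 → ℝ) → ℂ}
    {G : Fin 3 → (Fin 3 → ℝ) → ℂ} (h : HasH1Gradient L f G) (j : Fin 3) (k : Fin 3 → ℤ) :
    coeff L (twistedGradient φ L f G j) k
      = Complex.I * ((freq φ k j / L : ℝ) : ℂ) * coeff L f k := by
  have := isProbabilityMeasure_cubeMeasure hL
  have hf := (memLp_cubeMeasure hL h.memLp).integrable one_le_two
  have hG := (memLp_cubeMeasure hL (h.memLp_gradient j)).integrable one_le_two
  unfold twistedGradient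
  rw [coeff_add hG (hf.const_mul _), coeff_const_mul, coeff_weakPartial hL (h.weak j), freq]
  push_cast
  ring

theorem memLp_twistedGradient {φ L : ℝ} {f : (Fin 3 → ℝ) → ℂ}
    {G : Fin 3 → (Fin 3 → ℝ) → ℂ} (h : HasH1Gradient L f G) (j : Fin 3) :
    MemLp (twistedGradient φ L f G j) 2 (volume.restrict (cube L)) :=
  (h.memLp_gradient j).add (h.memLp.const_mul _)

theorem normSq_cube {L : ℝ} (hL : 0 < L) (u : (Fin 3 → ℝ) → ℂ) :
    normSq (cube L) u = L ^ 3 * ∫ x, ‖u x‖ ^ 2 ∂cubeMeasure L := by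
  rw [integral_cubeMeasure hL, smul_eq_mul, normSq]
  field_simp

theorem vecNormSq_cube {L : ℝ} (hL : 0 < L) {V : Fin 3 → (Fin 3 → ℝ) → ℂ}
    (hV : ∀ j, MemLp (V j) 2 (volume.restrict (cube L))) :
    vecNormSq (cube L) V = L ^ 3 * ∑ j, ∫ x, ‖V j x‖ ^ 2 ∂cubeMeasure L := by
  rw [vecNormSq, integral_finsetSum _ fun j _ => (hV j).norm.integrable_sq, Finset.mul_sum]
  exact Finset.sum_congr rfl fun j _ => normSq_cube hL (V j)

theorem vecNormSq_subset {L : ℝ} (hL : 0 < L) {Ω : Set (Fin 3 → ℝ)} (hΩ : Ω ⊆ cube L)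
    (hm : NullMeasurableSet Ω volume) {V : Fin 3 → (Fin 3 → ℝ) → ℂ}
    (hV : ∀ j, MemLp (V j) 2 (volume.restrict (cube L))) :
    vecNormSq Ω V
      = L ^ 3 * ∑ j, ∫ x, ‖(cube L \ Ω)ᶜ.indicator (V j) x‖ ^ 2 ∂cubeMeasure L := by
  have hcube : MeasurableSet (cube L) := measurableSet_Icc
  have hm' : NullMeasurableSet Ω (volume.restrict (cube L)) :=
    hm.mono_ac Measure.restrict_le_self.absolutelyContinuous
  have hS : NullMeasurableSet (cube L \ Ω)ᶜ (volume.restrict (cube L)) :=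
    (hcube.nullMeasurableSet.diff hm').compl
  rw [← vecNormSq_cube hL fun j => (hV j).mono ((hV j).1.indicator₀ hS)
      (Filter.Eventually.of_forall fun x => norm_indicator_le_norm_self _ x),
    vecNormSq, vecNormSq]
  have h1 : volume.restrict Ω = (volume.restrict (cube L)).restrict Ω := by
    rw [Measure.restrict_restrict₀ hm', Set.inter_eq_left.2 hΩ]
  rw [h1, ← integral_indicator₀ hm']
  refine setIntegral_congr_fun hcube fun x hx => ?_
  by_cases hxΩ : x ∈ Ω <;> simp [hx, hxΩ]

theorem real_cubeMeasure {L : ℝ} (hL : 0 < L) {S : Set (Fin 3 → ℝ)} (hS : S ⊆ cube L) :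
    (cubeMeasure L).real S = volume.real S / volume.real (cube L) := by
  rw [Measure.real, Measure.real, Measure.real, cubeMeasure, Measure.smul_apply,
    Measure.restrict_apply' (show MeasurableSet (cube L) from measurableSet_Icc), Set.inter_eq_left.2 hS,
    volume_cube hL, smul_eq_mul, ENNReal.toReal_mul, ENNReal.toReal_inv]
  exact inv_mul_eq_div _ _

end TwistedPoincare

open TwistedPoincare in
theorem lemma2 (φ : ℝ) (hφ : |φ| < Real.pi) :
    ∃ c : ℝ, 0 < c ∧ ∃ C : ℝ, ∀ L : ℝ, 0 < L →
      ∀ Ω : Set (Fin 3 → ℝ), Ω ⊆ cube L → NullMeasurableSet Ω volume →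
      ∀ (f : (Fin 3 → ℝ) → ℂ) (G : Fin 3 → (Fin 3 → ℝ) → ℂ), HasH1Gradient L f G →
        φ ^ 2 / L ^ 2 * normSq (cube L) f
            + c / L ^ 2 * normSq (cube L) (fun x => f x - mean L f)
            - C * (vecNormSq (cube L) (twistedGradient φ L f G)
                + 1 / L ^ 2 * normSq (cube L) f)
              * Real.sqrt (volume.real (cube L \ Ω) / volume.real (cube L))
          ≤ vecNormSq Ω (twistedGradient φ L f G) := by
  have hlt : φ ^ 2 < (2 * Real.pi - |φ|) ^ 2 := by
    rw [← sq_abs φ]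
    exact pow_lt_pow_left₀ (by linarith) (abs_nonneg φ) two_ne_zero
  -- any `A` strictly between `φ²` and the spectral gap will do
  obtain ⟨A, hA0, hAG⟩ := exists_between hlt
  refine ⟨A - φ ^ 2, sub_pos.2 hA0,
    2 + A * (2 * Real.pi - |φ|) ^ 2 / ((2 * Real.pi - |φ|) ^ 2 - A)
      * √(∑' k, (freqSq φ k)⁻¹ ^ 2), fun L hL Ω hΩ hm f G h => ?_⟩
  have hcube : MeasurableSet (cube L) := measurableSet_Icc
  have hac : cubeMeasure L ≪ volume :=
    Measure.smul_absolutelyContinuous.trans Measure.restrict_le_self.absolutelyContinuous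
  have hS : NullMeasurableSet (cube L \ Ω) (cubeMeasure L) :=
    (hcube.nullMeasurableSet.diff hm).mono_ac hac
  have key := poincare_of_coeff hφ hA0.le hAG hL hS (memLp_cubeMeasure hL h.memLp)
    (fun j => memLp_cubeMeasure hL (memLp_twistedGradient (φ := φ) h j))
    (coeff_twistedGradient hL h)
  rw [real_cubeMeasure hL Set.sdiff_subset] at key
  rw [vecNormSq_subset hL hΩ hm (memLp_twistedGradient h),
    vecNormSq_cube hL (memLp_twistedGradient h), normSq_cube hL, normSq_cube hL]
  have hC : 0 ≤ 2 + A * (2 * Real.pi - |φ|) ^ 2 / ((2 * Real.pi - |φ|) ^ 2 - A)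
      * √(∑' k, (freqSq φ k)⁻¹ ^ 2) := by
    have := sub_pos.2 hAG
    have : 0 ≤ A := (sq_nonneg φ).trans hA0.le
    positivity
  generalize 2 + A * (2 * Real.pi - |φ|) ^ 2 / ((2 * Real.pi - |φ|) ^ 2 - A)
      * √(∑' k, (freqSq φ k)⁻¹ ^ 2) = C at hC key ⊢
  have hs := Real.sqrt_nonneg (volume.real (cube L \ Ω) / volume.real (cube L))
  generalize √(volume.real (cube L \ Ω) / volume.real (cube L)) = s at hs key ⊢
  have hF : 0 ≤ ∫ x, ‖f x‖ ^ 2 ∂cubeMeasure L := integral_nonneg fun x => sq_nonneg _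
  generalize ∫ x, ‖f x‖ ^ 2 ∂cubeMeasure L = F at hF key ⊢
  generalize ∫ x, ‖f x - mean L f‖ ^ 2 ∂cubeMeasure L = H at key ⊢
  have h1 := mul_le_mul_of_nonneg_left key hL.le
  have h2 : 0 ≤ C * (L * F) * s := by positivity
  have e1 : φ ^ 2 / L ^ 2 * (L ^ 3 * F) = L * (φ ^ 2 * F) := by field_simp
  have e2 : (A - φ ^ 2) / L ^ 2 * (L ^ 3 * H) = L * ((A - φ ^ 2) * H) := by field_simp
  have e3 : 1 / L ^ 2 * (L ^ 3 * F) = L * F := by field_simp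
  rw [e1, e2, e3]
  linarith
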